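/- Let $\nu$ be the morphism $0\to 01$, $1\to 2$, $2\to 0$, let $\mathbf n = 0120010120120\cdots$ be its unique infinite fixed point (the Narayana word), and let $N_k = |\nu^k(0)|$ for $k\ge 0$. A nonempty finite word $x = x_0\cdots x_{m-1}$ has period $p$, where $1\le p\le m$, if $x_i = x_{i+p}$ whenever $0 \le i < m-p$; $\operatorname{per}(x)$ denotes its smallest period, and $\exp(x) = |x|/\operatorname{per}(x)$. The critical exponent of an infinite word is the supremum of $\exp(x)$ over its nonempty finite factors $x$. The polynomial $X^3 - X^2 - 1$ has exactly one real root $\alpha \doteq 1.465571231876768026656731$, and the critical exponent of $\mathbf n$ is $$\beta = \frac{\alpha^2+\alpha+5}{3} \doteq 2.871156755860518460227649$$ (both decimal values with error less than $10^{-24}$). It is not attained: every nonempty factor $x$ of $\mathbf n$ satisfies $\exp(x) < \beta$. Moreover, call $(m,p)$ with $m \ge 1$ a maximal repetition of $\mathbf n$ if $p$ is the smallest value of $\operatorname{per}(x)$ over all factors $x$ of $\mathbf n$ of length $m$, and every factor of length greater than $m$ has $\operatorname{per} > p$. For $k \ge 0$ put $$\ell_k = \frac{N_{k+2}+N_{k+1}+5N_k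 - c_k}{3},\qquad c_k = 4 \text{ for even } k,\quad c_k = 5 \text{ for odd } k.$$ Then the $\ell_k$ are non-negative integers, the maximal repetitions $(m,p)$ of $\mathbf n$ with $m/p > 14/5$ are exactly the pairs $(\ell_k, N_k)$ with $k \ge 8$, and $\ell_k/N_k \to \beta$ as $k\to\infty$. -/

import Mathlib

namespace Narayana

/-- The factor `w[i..i+m-1]` of length `m` of the infinite word `w`. -/
def factorAt {A : Type*} (w : ℕ → A) (i m : ℕ) : List A :=
  (List.range m).map fun j => w (i + j)

/-- `x` is a (finite, contiguous) factor of the infinite word `w`. -/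
def IsFactor {A : Type*} (x : List A) (w : ℕ → A) : Prop :=
  ∃ i m : ℕ, x = factorAt w i m

/-- `w` is a fixed point of the (nonerasing) morphism induced by `f`:
the image of every prefix of `w` is a prefix of `w`. -/
def IsFixedPoint {A : Type*} (f : A → List A) (w : ℕ → A) : Prop :=
  ∀ m : ℕ, (factorAt w 0 m).flatMap f = factorAt w 0 ((factorAt w 0 m).flatMap f).length

/-- The period `per x` of a nonempty finite word `x`: the least `p` with `1 ≤ p ≤ |x|` that is a
period of `x`. (The set is nonempty for nonempty `x`, since it contains `|x|`.) -/
noncomputable def per {A : Type*} (x : List A) : ℕ :=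
  sInf {p : ℕ | 1 ≤ p ∧ p ≤ x.length ∧ x.HasPeriod p}

/-- The exponent `|x| / per x` of a nonempty finite word. -/
noncomputable def exponent {A : Type*} (x : List A) : ℝ :=
  (x.length : ℝ) / (per x : ℝ)

/-- The critical exponent of an infinite word: the supremum of the exponents of its nonempty
factors, taken in the extended reals. -/
noncomputable def criticalExponent {A : Type*} (w : ℕ → A) : EReal :=
  sSup {e : EReal | ∃ x : List A, x ≠ [] ∧ IsFactor x w ∧ e = ((exponent x : ℝ) : EReal)}

/-- `(m, p)` is a maximal repetition of `w`: the smallest period among all factors of length `m`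
is `p`, and every longer factor has period greater than `p`. -/
def IsMaximalRepetition {A : Type*} (w : ℕ → A) (m p : ℕ) : Prop :=
  0 < m ∧
  (∃ x : List A, IsFactor x w ∧ x.length = m ∧ per x = p) ∧
  (∀ x : List A, IsFactor x w → x.length = m → p ≤ per x) ∧
  (∀ x : List A, IsFactor x w → m < x.length → p < per x)

/-- The morphism `0 → 01`, `1 → 2`, `2 → 0` on letters. -/
def nu : Fin 3 → List (Fin 3)
  | 0 => [0, 1]
  | 1 => [2]
  | 2 => [0]

/-- The finite word `ν^k(0)`. -/
def nuIter : ℕ → List (Fin 3)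
  | 0 => [0]
  | k + 1 => (nuIter k).flatMap nu

/-- The Narayana number `N_k = |ν^k(0)|`. -/
def narayana (k : ℕ) : ℕ := (nuIter k).length

/-- The infinite Narayana word, the limit of the words `ν^k(0)`: its letter at position `i` is the
letter at position `i` of `ν^i(0)`, a word of length greater than `i`. -/
def word (i : ℕ) : Fin 3 := (nuIter i).getD i 0

theorem nuIter_prefix_succ (k : ℕ) : nuIter k <+: nuIter (k + 1) := by
  induction k with
  | zero => exact ⟨[1], rfl⟩
  | succ k ih =>
    obtain ⟨t, ht⟩ := ih
    refine ⟨t.flatMap nu, ?_⟩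
    change (nuIter k).flatMap nu ++ t.flatMap nu = (nuIter (k + 1)).flatMap nu
    rw [← ht, List.flatMap_append]

theorem nuIter_prefix {k l : ℕ} (h : k ≤ l) : nuIter k <+: nuIter l := by
  induction l, h using Nat.le_induction with
  | base => exact List.prefix_rfl
  | succ l _ ih => exact ih.trans (nuIter_prefix_succ l)

theorem length_le_flatMap (x : List (Fin 3)) : x.length ≤ (x.flatMap nu).length := by
  induction x with
  | nil => simp
  | cons a x ih =>
    have : 1 ≤ (nu a).length := by fin_cases a <;> simp [nu]
    simp only [List.flatMap_cons, List.length_append, List.length_cons]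
    omega

theorem nuIter_eq_cons (k : ℕ) : ∃ t, nuIter k = 0 :: t := by
  obtain ⟨t, ht⟩ := nuIter_prefix (Nat.zero_le k)
  exact ⟨t, ht.symm⟩

theorem lt_length_nuIter (k : ℕ) : k < (nuIter k).length := by
  induction k with
  | zero => simp [nuIter]
  | succ k ih =>
    obtain ⟨t, ht⟩ := nuIter_eq_cons k
    have h := length_le_flatMap t
    have e : nuIter (k + 1) = nu 0 ++ t.flatMap nu := by
      simp [nuIter, ht]
    rw [ht] at ih
    rw [e]
    simp only [nu, List.length_append, List.length_cons, List.length_nil] at ih ⊢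
    omega

theorem word_eq_of_lt {i k : ℕ} (h : i < (nuIter k).length) : word i = (nuIter k)[i] := by
  have hi := lt_length_nuIter i
  have e : word i = (nuIter i)[i] := by simp [word, hi]
  rw [e]
  rcases le_total i k with hik | hik
  · exact (nuIter_prefix hik).getElem hi
  · exact ((nuIter_prefix hik).getElem h).symm

theorem factorAt_of_prefix {x : List (Fin 3)} {k : ℕ} (h : x <+: nuIter k) :
    factorAt word 0 x.length = x := by
  apply List.ext_getElem
  · simp [factorAt]
  · intro i h1 h2
    have h3 : i < (nuIter k).length := lt_of_lt_of_le h2 h.length_le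
    simp only [factorAt, List.getElem_map, List.getElem_range, zero_add]
    rw [word_eq_of_lt h3]
    exact (h.getElem h2).symm

theorem factorAt_prefix_nuIter (m : ℕ) : factorAt word 0 m <+: nuIter m := by
  have h : (nuIter m).take m <+: nuIter m := List.take_prefix _ _
  have e := factorAt_of_prefix h
  rw [List.length_take, min_eq_left (lt_length_nuIter m).le] at e
  rw [e]
  exact h

/-- The Narayana word is a fixed point of the morphism. -/
theorem word_isFixedPoint : IsFixedPoint nu word := by
  intro m
  obtain ⟨t, ht⟩ := factorAt_prefix_nuIter m
  have h : (factorAt word 0 m).flatMap nu <+: nuIter (m + 1) := by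
    refine ⟨t.flatMap nu, ?_⟩
    rw [← List.flatMap_append, ht]
    rfl
  exact (factorAt_of_prefix h).symm

/-- The Narayana word is the only infinite fixed point of the morphism. -/
theorem eq_word_of_isFixedPoint {w : ℕ → Fin 3} (hw : IsFixedPoint nu w) : w = word := by
  have h0 : w 0 = 0 := by
    have h := hw 1
    have e : factorAt w 0 1 = [w 0] := by simp [factorAt]
    rw [e] at h
    generalize hx : w 0 = a at h
    fin_cases a
    · rfl
    · simp [nu, factorAt, hx] at h
    · simp [nu, factorAt, hx] at h
  have key : ∀ k, factorAt w 0 (nuIter k).length = nuIter k := by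
    intro k
    induction k with
    | zero => simp [nuIter, factorAt, h0]
    | succ k ih =>
      have h := hw (nuIter k).length
      rw [ih] at h
      exact h.symm
  funext i
  have hi := lt_length_nuIter i
  rw [word_eq_of_lt hi]
  have h := List.getElem_of_eq (key i).symm hi
  rw [h]
  simp [factorAt]

end Narayana

namespace Narayana

/-! A factor of length m with period p < m is a pair of occurrences, at distance p, of one word of
length m - p, so the question is how long two occurrences can agree. Desubstitution answers it. Two
equal letters other than 1 come from equal letters one level down, or from a 0 and a 2; a 1 is
reduced to the 0 before it. Hence every agreement lies inside the image, under some iterate ν^k, of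
a pair of positions a < b holding 0 and 2 (`exists_overlapping`). There the agreement stops after
exactly `overlap k` letters (`Overlapping.succ`), while the shift is the length of ν^k applied to
the block from a to b, which is shortest when the block is the single letter 2. This gives
`repetition_bound`, sharp by `exists_repetition`.

The extremal exponents are therefore 1 + `overlap (k + 1)` / N_k. Letter counts give
`overlap_succ_eq`, and N_{k+1} - αN_k is bounded tightly enough (`abs_narayana_succ_sub_le`) that
the negative constant in the closed form keeps every exponent strictly below β, while the extremal
ones converge to it. -/

/-! ### The cutting points of the morphism -/

/-- The length of the image under `nu` of the prefix of length `j` of the Narayana word. -/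
def cut (j : ℕ) : ℕ := ((factorAt word 0 j).flatMap nu).length

theorem factorAt_succ {A : Type*} (w : ℕ → A) (i m : ℕ) :
    factorAt w i (m + 1) = factorAt w i m ++ [w (i + m)] := by
  simp [factorAt, List.range_succ]

theorem length_factorAt {A : Type*} (w : ℕ → A) (i m : ℕ) : (factorAt w i m).length = m := by
  simp [factorAt]

theorem cut_zero : cut 0 = 0 := by simp [cut, factorAt]

theorem cut_succ (j : ℕ) : cut (j + 1) = cut j + (nu (word j)).length := by
  simp [cut, factorAt_succ]

theorem word_cut_add {j t : ℕ} (ht : t < (nu (word j)).length) :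
    word (cut j + t) = (nu (word j))[t] := by
  have h := word_isFixedPoint (j + 1)
  have e : (factorAt word 0 (j + 1)).flatMap nu =
      (factorAt word 0 j).flatMap nu ++ nu (word j) := by
    simp [factorAt_succ]
  have h2 := congrArg (fun l => l[cut j + t]?) h
  simp only [e] at h2
  rw [List.getElem?_append_right (by simp [cut])] at h2
  have h3 : cut j + t < ((factorAt word 0 j).flatMap nu ++ nu (word j)).length := by
    simp only [List.length_append]; exact Nat.add_lt_add_left ht _
  rw [List.getElem?_eq_getElem (by simpa [cut] using ht),
    List.getElem?_eq_getElem (by rw [length_factorAt]; exact h3), Option.some_inj] at h2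
  simpa [factorAt, cut] using h2.symm

theorem cut_of_zero {j : ℕ} (h : word j = 0) :
    cut (j + 1) = cut j + 2 ∧ word (cut j) = 0 ∧ word (cut j + 1) = 1 := by
  refine ⟨by rw [cut_succ, h]; rfl, ?_, ?_⟩
  · have := word_cut_add (j := j) (t := 0) (by simp [h, nu])
    simpa [h, nu] using this
  · have := word_cut_add (j := j) (t := 1) (by simp [h, nu])
    simpa [h, nu] using this

theorem cut_of_one {j : ℕ} (h : word j = 1) : cut (j + 1) = cut j + 1 ∧ word (cut j) = 2 := by
  refine ⟨by rw [cut_succ, h]; rfl, ?_⟩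
  have := word_cut_add (j := j) (t := 0) (by simp [h, nu])
  simpa [h, nu] using this

theorem cut_of_two {j : ℕ} (h : word j = 2) : cut (j + 1) = cut j + 1 ∧ word (cut j) = 0 := by
  refine ⟨by rw [cut_succ, h]; rfl, ?_⟩
  have := word_cut_add (j := j) (t := 0) (by simp [h, nu])
  simpa [h, nu] using this

theorem letter_cases (a : Fin 3) : a = 0 ∨ a = 1 ∨ a = 2 := by
  fin_cases a <;> simp

theorem cut_strictMono : StrictMono cut := by
  refine strictMono_nat_of_lt_succ fun j => ?_
  rcases letter_cases (word j) with h | h | h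
  · have := cut_of_zero h; omega
  · have := cut_of_one h; omega
  · have := cut_of_two h; omega

theorem exists_cut (x : ℕ) : ∃ j, x = cut j ∨ (word j = 0 ∧ x = cut j + 1) := by
  induction x with
  | zero => exact ⟨0, Or.inl cut_zero.symm⟩
  | succ x ih =>
    obtain ⟨j, h | ⟨h0, h⟩⟩ := ih
    · rcases letter_cases (word j) with hj | hj | hj
      · exact ⟨j, Or.inr ⟨hj, by omega⟩⟩
      · exact ⟨j + 1, Or.inl (by have := cut_of_one hj; omega)⟩
      · exact ⟨j + 1, Or.inl (by have := cut_of_two hj; omega)⟩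
    · exact ⟨j + 1, Or.inl (by have := cut_of_zero h0; omega)⟩

theorem word_cut_ne_one (j : ℕ) : word (cut j) ≠ 1 := by
  rcases letter_cases (word j) with h | h | h
  · rw [(cut_of_zero h).2.1]; decide
  · rw [(cut_of_one h).2]; decide
  · rw [(cut_of_two h).2]; decide

theorem exists_eq_cut {x : ℕ} (h : word x ≠ 1) : ∃ j, x = cut j := by
  obtain ⟨j, hj | ⟨h0, hj⟩⟩ := exists_cut x
  · exact ⟨j, hj⟩
  · exact absurd (hj ▸ (cut_of_zero h0).2.2) h

theorem exists_of_word_eq_one {x : ℕ} (h : word x = 1) : ∃ y, x = y + 1 ∧ word y = 0 := by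
  obtain ⟨j, hj | ⟨h0, hj⟩⟩ := exists_cut x
  · exact absurd (hj ▸ h) (word_cut_ne_one j)
  · exact ⟨cut j, hj, (cut_of_zero h0).2.1⟩

theorem word_succ_of_two {x : ℕ} (h : word x = 2) : word (x + 1) = 0 := by
  obtain ⟨j, rfl⟩ := exists_eq_cut (x := x) (by rw [h]; decide)
  rcases letter_cases (word j) with hj | hj | hj
  · rw [(cut_of_zero hj).2.1] at h; exact absurd h (by decide)
  · rw [← (cut_of_one hj).1]
    rcases letter_cases (word (j + 1)) with hk | hk | hk
    · exact (cut_of_zero hk).2.1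
    · obtain ⟨y, hy, hy0⟩ := exists_of_word_eq_one hk
      obtain rfl : j = y := by omega
      rw [hj] at hy0
      exact absurd hy0 (by decide)
    · exact (cut_of_two hk).2
  · rw [(cut_of_two hj).2] at h; exact absurd h (by decide)

/-- The letters at two cutting points agree only if the letters they come from agree or are
`0` and `2`. -/
theorem word_eq_or_of_word_cut_eq {a b : ℕ} (h : word (cut a) = word (cut b)) :
    word a = word b ∨ (word a = 0 ∧ word b = 2) ∨ (word a = 2 ∧ word b = 0) := by
  rcases letter_cases (word a) with ha | ha | ha <;>
    rcases letter_cases (word b) with hb | hb | hb <;> simp only [ha, hb] <;>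
    first
    | decide
    | (exfalso
       simp only [cut_of_zero, cut_of_one, cut_of_two, ha, hb] at h
       exact absurd h (by decide))

/-- Equal factors have equal images. -/
theorem cut_add_eq {a b L : ℕ} (h : ∀ t < L, word (a + t) = word (b + t)) :
    cut (a + L) + cut b = cut (b + L) + cut a ∧
      ∀ t < cut (b + L) - cut b, word (cut a + t) = word (cut b + t) := by
  induction L with
  | zero => simp [Nat.add_comm]
  | succ L ih =>
    obtain ⟨h1, h2⟩ := ih fun t ht => h t (by omega)
    have hL := h L (by omega)
    have ea := cut_succ (a + L)
    have eb := cut_succ (b + L)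
    have ma := cut_strictMono.monotone (Nat.le_add_right a L)
    have mb := cut_strictMono.monotone (Nat.le_add_right b L)
    refine ⟨by rw [← Nat.add_assoc, ← Nat.add_assoc, ea, eb, hL]; omega, fun t ht => ?_⟩
    by_cases h3 : t < cut (b + L) - cut b
    · exact h2 t h3
    · obtain ⟨u, rfl⟩ : ∃ u, t = cut (b + L) - cut b + u := ⟨_, (Nat.add_sub_cancel' (by omega)).symm⟩
      rw [← Nat.add_assoc, eb] at ht
      have hu : u < (nu (word (b + L))).length := by omega
      have e1 : cut a + (cut (b + L) - cut b + u) = cut (a + L) + u := by omega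
      have e2 : cut b + (cut (b + L) - cut b + u) = cut (b + L) + u := by omega
      rw [e1, e2, word_cut_add hu, word_cut_add (by rw [hL]; exact hu)]
      simp only [hL]

/-! ### Lengths of the overlaps -/

/-- The lengths of the maximal overlaps of the Narayana word with its shifts. -/
def overlap : ℕ → ℕ
  | 0 => 0
  | k + 1 => cut (overlap k) + if Even k then 1 else 0

theorem overlap_succ (k : ℕ) : overlap (k + 1) = cut (overlap k) + if Even k then 1 else 0 := rfl

theorem word_zero : word 0 = 0 := rfl

/-- Needed to see that the letter 0 gained at an even step also continues the prefix of the word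
itself. -/
theorem word_overlap (k : ℕ) :
    (Even k → word (overlap k) = 0 ∨ word (overlap k) = 2) ∧
      (¬ Even k → word (overlap k) = 0 ∨ word (overlap k) = 1) := by
  induction k with
  | zero => exact ⟨fun _ => Or.inl word_zero, fun h => absurd Even.zero h⟩
  | succ k ih =>
    rw [overlap_succ, Nat.even_add_one, not_not]
    refine ⟨fun hk => ?_, fun hk => ?_⟩
    · rw [if_neg hk, Nat.add_zero]
      rcases ih.2 hk with h | h
      · exact Or.inl (cut_of_zero h).2.1
      · exact Or.inr (cut_of_one h).2
    · rw [if_pos hk]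
      rcases ih.1 hk with h | h
      · exact Or.inr (cut_of_zero h).2.2
      · rw [← (cut_of_two h).1]
        exact Or.inl (cut_of_zero (word_succ_of_two h)).2.1

/-- `a` and `b` hold the letters `c` and `d`, in one order or the other. -/
def Letters (c d : Fin 3) (a b : ℕ) : Prop :=
  (word a = c ∧ word b = d) ∨ (word a = d ∧ word b = c)

/-- At the positions `a` and `b` the Narayana word agrees with its prefix of length `overlap k`,
and these two occurrences of the prefix are followed by different letters. -/
def Overlapping (k a b : ℕ) : Prop :=
  (∀ t < overlap k, word (a + t) = word t) ∧ (∀ t < overlap k, word (b + t) = word t) ∧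
    Letters 0 (if Even k then 2 else 1) (a + overlap k) (b + overlap k)

theorem cut_add_of_prefix {a L : ℕ} (h : ∀ t < L, word (a + t) = word t) :
    cut (a + L) = cut a + cut L ∧ ∀ t < cut L, word (cut a + t) = word t := by
  obtain ⟨h1, h2⟩ := cut_add_eq (a := a) (b := 0) (L := L) (by simpa using h)
  simp only [Nat.zero_add, cut_zero, Nat.sub_zero, Nat.add_zero] at h1 h2
  exact ⟨by omega, h2⟩

/-- A mismatch {0, 2} becomes 01 against 0 followed by 0, since 2 is always followed by 0: one more
common letter, then {0, 1}. A mismatch {0, 1} becomes 01 against 2, which is {0, 2} at once. This is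
the parity term in `overlap`. -/
theorem Overlapping.succ {k a b : ℕ} (h : Overlapping k a b) :
    Overlapping (k + 1) (cut a) (cut b) := by
  obtain ⟨ha, hb, hl⟩ := h
  obtain ⟨ca, pa⟩ := cut_add_of_prefix ha
  obtain ⟨cb, pb⟩ := cut_add_of_prefix hb
  by_cases hk : Even k
  · have hk' : ¬ Even (k + 1) := by rw [Nat.even_add_one, not_not]; exact hk
    have hz : word (cut (overlap k)) = 0 := by
      rcases (word_overlap k).1 hk with h | h
      · exact (cut_of_zero h).2.1
      · exact (cut_of_two h).2
    have key : ∀ x, word x = 0 ∨ word x = 2 → word (cut x) = 0 := by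
      rintro x (h | h)
      · exact (cut_of_zero h).2.1
      · exact (cut_of_two h).2
    have key2 : ∀ x, word x = 2 → word (cut x + 1) = 0 := by
      intro x h
      rw [← (cut_of_two h).1]
      exact (cut_of_zero (word_succ_of_two h)).2.1
    have ext : ∀ c, (∀ t < cut (overlap k), word (c + t) = word t) →
        word (c + cut (overlap k)) = 0 → ∀ t < cut (overlap k) + 1, word (c + t) = word t := by
      intro c hc h0 t ht
      rcases Nat.lt_succ_iff_lt_or_eq.1 ht with h | rfl
      · exact hc t h
      · rw [h0, hz]
    simp only [Overlapping, overlap_succ, if_pos hk, if_neg hk', ← Nat.add_assoc, Letters] at hl ⊢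
    rw [← ca, ← cb]
    refine ⟨ext _ pa ?_, ext _ pb ?_, ?_⟩
    · rw [← ca]; exact key _ (by tauto)
    · rw [← cb]; exact key _ (by tauto)
    · rcases hl with ⟨h1, h2⟩ | ⟨h1, h2⟩
      · exact Or.inr ⟨(cut_of_zero h1).2.2, key2 _ h2⟩
      · exact Or.inl ⟨key2 _ h1, (cut_of_zero h2).2.2⟩
  · have hk' : Even (k + 1) := by rw [Nat.even_add_one]; exact hk
    simp only [Overlapping, overlap_succ, if_neg hk, if_pos hk', Nat.add_zero, Letters] at hl ⊢
    rw [← ca, ← cb]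
    refine ⟨pa, pb, ?_⟩
    rcases hl with ⟨h1, h2⟩ | ⟨h1, h2⟩
    · exact Or.inl ⟨(cut_of_zero h1).2.1, (cut_of_one h2).2⟩
    · exact Or.inr ⟨(cut_of_one h1).2, (cut_of_zero h2).2.1⟩

theorem overlapping_iterate {a b : ℕ} (h : Letters 0 2 a b) (k : ℕ) :
    Overlapping k (cut^[k] a) (cut^[k] b) := by
  induction k with
  | zero => simpa [Overlapping, overlap] using h
  | succ k ih =>
    rw [Function.iterate_succ_apply', Function.iterate_succ_apply']
    exact ih.succ

theorem Overlapping.ne {k a b : ℕ} (h : Overlapping k a b) :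
    word (a + overlap k) ≠ word (b + overlap k) := by
  obtain ⟨-, -, ⟨h1, h2⟩ | ⟨h1, h2⟩⟩ := h <;> rw [h1, h2] <;> split_ifs <;> decide

/-- Any two equal letters lie in a pair of overlapping occurrences that is the iterated image of
two positions with the letters `0` and `2`. -/
theorem exists_overlapping {x y : ℕ} (hxy : x < y) (h : word x = word y) :
    ∃ k a b d, a < b ∧ Letters 0 2 a b ∧ cut^[k] a + d = x ∧ cut^[k] b + d = y ∧
      d < overlap k := by
  induction y using Nat.strong_induction_on generalizing x with
  | _ y ih =>
  by_cases h1 : word x = 1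
  · obtain ⟨x', rfl, hx⟩ := exists_of_word_eq_one h1
    obtain ⟨y', rfl, hy⟩ := exists_of_word_eq_one (h ▸ h1)
    obtain ⟨k, a, b, d, hab, hl, ha, hb, hd⟩ := ih y' (by omega) (x := x') (by omega) (hx.trans hy.symm)
    refine ⟨k, a, b, d + 1, hab, hl, by omega, by omega, ?_⟩
    -- The letters just past the overlap differ, so the two equal 1s are still inside it.
    have hne := (overlapping_iterate hl k).ne
    by_contra hcon
    have hd' : overlap k = d + 1 := by omega
    rw [hd', ← Nat.add_assoc, ← Nat.add_assoc, ha, hb] at hne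
    exact hne h
  · obtain ⟨i, rfl⟩ := exists_eq_cut h1
    obtain ⟨j, rfl⟩ := exists_eq_cut (h ▸ h1)
    have hij : i < j := cut_strictMono.lt_iff_lt.1 hxy
    by_cases he : word i = word j
    · have hj : j < cut j := by
        have h0 := (cut_of_zero word_zero).1
        rw [cut_zero] at h0
        have : ∀ n, n + 1 < cut (n + 1) := by
          intro n
          induction n with
          | zero => omega
          | succ n ihn => exact lt_of_le_of_lt ihn (cut_strictMono (Nat.lt_succ_self _))
        obtain ⟨n, rfl⟩ : ∃ n, j = n + 1 := ⟨j - 1, by omega⟩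
        exact this n
      obtain ⟨k, a, b, d, hab, hl, ha, hb, hd⟩ := ih j hj hij he
      obtain ⟨pa, pb, hlk⟩ := overlapping_iterate hl k
      obtain ⟨ea, -⟩ := cut_add_of_prefix (a := cut^[k] a) (L := d) fun t ht => pa t (by omega)
      obtain ⟨eb, -⟩ := cut_add_of_prefix (a := cut^[k] b) (L := d) fun t ht => pb t (by omega)
      refine ⟨k + 1, a, b, cut d, hab, hl, ?_, ?_, ?_⟩
      · rw [Function.iterate_succ_apply', ← ea, ha]
      · rw [Function.iterate_succ_apply', ← eb, hb]
      · rw [overlap_succ]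
        have := cut_strictMono hd
        omega
    · have hl : Letters 0 2 i j := (word_eq_or_of_word_cut_eq h).resolve_left he
      -- A 0 and a 2 have images that share their first letter, and `overlap 1 = 1`.
      exact ⟨1, i, j, 0, hij, hl, rfl, rfl, by simp [overlap]⟩

/-! ### Lengths of iterated images of letters -/

theorem cut_narayana (k : ℕ) : cut (narayana k) = narayana (k + 1) := by
  rw [cut, narayana, factorAt_of_prefix (List.prefix_refl _)]
  rfl

/-- Everything reduces to the letter 0, because ν(2) = 0 and ν²(1) = 0. -/
theorem cut_iterate_succ (k a : ℕ) :
    (word a = 0 → cut^[k] (a + 1) = cut^[k] a + narayana k) ∧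
    (word a = 2 → cut^[k + 1] (a + 1) = cut^[k + 1] a + narayana k) ∧
    (word a = 1 → cut^[k + 2] (a + 1) = cut^[k + 2] a + narayana k) := by
  have zero_case : ∀ k a, word a = 0 → cut^[k] (a + 1) = cut^[k] a + narayana k := by
    intro k a h
    have e0 : ∀ k, cut^[k] 0 = 0 := fun k => by
      induction k with
      | zero => rfl
      | succ k ih => rw [Function.iterate_succ_apply', ih, cut_zero]
    have e1 : ∀ k, cut^[k] 1 = narayana k := fun k => by
      induction k with
      | zero => rfl
      | succ k ih => rw [Function.iterate_succ_apply', ih, cut_narayana]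
    have main : ∀ k, cut^[k] (a + 1) = cut^[k] a + cut^[k] 1 ∧
        ∀ t < cut^[k] 1, word (cut^[k] a + t) = word t := by
      intro k
      induction k with
      | zero => simpa [word_zero] using h
      | succ k ih =>
        simp only [Function.iterate_succ_apply']
        rw [ih.1]
        exact cut_add_of_prefix ih.2
    rw [(main k).1, e1]
  refine ⟨zero_case k a, fun h => ?_, fun h => ?_⟩
  · rw [Function.iterate_succ_apply, Function.iterate_succ_apply, (cut_of_two h).1]
    exact zero_case k _ (cut_of_two h).2
  · simp only [Function.iterate_succ_apply]
    rw [(cut_of_one h).1, (cut_of_two (cut_of_one h).2).1]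
    exact zero_case k _ (cut_of_two (cut_of_one h).2).2

/-- Lengths in ν^{k+3}(0) = ν^{k+2}(0) ν^{k+2}(1), with ν^{k+2}(1) = ν^k(0). -/
theorem narayana_add_three (k : ℕ) : narayana (k + 3) = narayana (k + 2) + narayana k := by
  have h1 := (cut_iterate_succ (k + 3) 0).1 word_zero
  have h2 := (cut_iterate_succ (k + 2) 0).1 word_zero
  have w1 : word 1 = 1 := rfl
  have h3 := (cut_iterate_succ k 1).2.2 w1
  have c : cut 1 = 2 := rfl
  rw [Function.iterate_succ_apply, Function.iterate_succ_apply _ _ 0, cut_zero, Nat.zero_add, c] at h1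
  rw [Nat.zero_add] at h2
  change cut^[k + 2] 2 = _ at h3
  omega

theorem narayana_lt_succ (k : ℕ) : narayana k < narayana (k + 1) := by
  induction k using Nat.strong_induction_on with
  | _ k ih =>
  match k with
  | 0 => decide
  | 1 => decide
  | 2 => decide
  | k + 3 =>
    have h1 := ih k (by omega)
    have h2 := ih (k + 2) (by omega)
    have e1 := narayana_add_three k
    have e2 := narayana_add_three (k + 1)
    simp only [Nat.add_assoc, Nat.reduceAdd] at *
    omega

theorem narayana_strictMono : StrictMono narayana := strictMono_nat_of_lt_succ narayana_lt_succ

theorem cut_iterate_strictMono (k : ℕ) : StrictMono cut^[k] := cut_strictMono.iterate k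

/-! ### Repetitions -/

/-- Every repetition is at most as long as one of the extremal ones with at most its period. -/
theorem repetition_bound {i L p : ℕ} (hp : 0 < p) (hL : 0 < L)
    (h : ∀ t < L, word (i + t) = word (i + p + t)) :
    ∃ k, L ≤ overlap (k + 1) ∧ (p = narayana k ∨ narayana (k + 1) ≤ p) := by
  obtain ⟨k, a, b, d, hab, hl, ha, hb, hd⟩ :=
    exists_overlapping (x := i) (y := i + p) (by omega) (by simpa using h 0 hL)
  obtain ⟨k, rfl⟩ : ∃ k', k = k' + 1 := by
    cases k with
    | zero => simp [overlap] at hd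
    | succ k => exact ⟨k, rfl⟩
  have hne := (overlapping_iterate hl (k + 1)).ne
  refine ⟨k, ?_, ?_⟩
  · by_contra hcon
    have := h (overlap (k + 1) - d) (by omega)
    rw [show i + (overlap (k + 1) - d) = cut^[k + 1] a + overlap (k + 1) by omega,
      show i + p + (overlap (k + 1) - d) = cut^[k + 1] b + overlap (k + 1) by omega] at this
    exact hne this
  -- The shift is the length of ν^{k+1} of the block from a to b. A block starting with 0 gives at
  -- least N_{k+1}; the block 2 gives N_k; a longer block starts with 20 and gives at least N_k +
  -- N_{k+1}.
  · have hp' : cut^[k + 1] a + p = cut^[k + 1] b := by omega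
    rcases hl with ⟨h0, -⟩ | ⟨h2, -⟩
    · have := (cut_iterate_succ (k + 1) a).1 h0
      have := (cut_iterate_strictMono (k + 1)).monotone (show a + 1 ≤ b from hab)
      omega
    · have e := (cut_iterate_succ k a).2.1 h2
      rcases Nat.eq_or_lt_of_le (show a + 1 ≤ b from hab) with rfl | hb2
      · omega
      · have := (cut_iterate_succ (k + 1) (a + 1)).1 (word_succ_of_two h2)
        have := (cut_iterate_strictMono (k + 1)).monotone (show a + 1 + 1 ≤ b from hb2)
        omega

/-- The extremal repetitions occur. -/
theorem exists_repetition (k : ℕ) :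
    ∃ i, ∀ t < overlap (k + 1), word (i + t) = word (i + narayana k + t) := by
  have h2 : word 2 = 2 := rfl
  -- Positions 2 and 3 hold 2 and 0, so the block between them is the single letter 2, the shortest
  -- shift.
  have hl : Letters 0 2 2 3 := Or.inr ⟨h2, rfl⟩
  obtain ⟨pa, pb, -⟩ := overlapping_iterate hl (k + 1)
  have e := (cut_iterate_succ k 2).2.1 h2
  refine ⟨cut^[k + 1] 2, fun t ht => ?_⟩
  rw [← e, pa t ht]
  exact (pb t ht).symm

/-! ### Closed form of the overlap lengths -/

/-- The number of occurrences of the letter `a` in the prefix of length `x`. -/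
def letterCount (a : Fin 3) (x : ℕ) : ℕ := ((List.range x).map word).count a

theorem letterCount_succ (a : Fin 3) (x : ℕ) :
    letterCount a (x + 1) = letterCount a x + if word x = a then 1 else 0 := by
  simp [letterCount, List.range_succ, List.count_append, List.count_singleton]

/-- The incidence matrix of ν acting on the letter counts of a prefix. -/
theorem letterCount_cut (x : ℕ) :
    letterCount 0 (cut x) = letterCount 0 x + letterCount 2 x ∧
    letterCount 1 (cut x) = letterCount 0 x ∧
    letterCount 2 (cut x) = letterCount 1 x ∧
    cut x = 2 * letterCount 0 x + letterCount 1 x + letterCount 2 x ∧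
    x = letterCount 0 x + letterCount 1 x + letterCount 2 x := by
  induction x with
  | zero => simp [cut_zero, letterCount]
  | succ x ih =>
    rcases letter_cases (word x) with h | h | h
    · obtain ⟨e, e1, e2⟩ := cut_of_zero h
      simp [e, letterCount_succ, h, e1, e2, show cut x + 2 = cut x + 1 + 1 from rfl]
      omega
    · obtain ⟨e, e1⟩ := cut_of_one h
      simp [e, letterCount_succ, h, e1]
      omega
    · obtain ⟨e, e1⟩ := cut_of_two h
      simp [e, letterCount_succ, h, e1]
      omega

theorem letterCount_overlap_succ (k : ℕ) :
    letterCount 0 (overlap (k + 1)) = letterCount 0 (overlap k) + letterCount 2 (overlap k) +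
        (if Even k then 1 else 0) ∧
    letterCount 1 (overlap (k + 1)) = letterCount 0 (overlap k) ∧
    letterCount 2 (overlap (k + 1)) = letterCount 1 (overlap k) := by
  obtain ⟨h0, h1, h2, -, -⟩ := letterCount_cut (overlap k)
  rw [overlap_succ]
  by_cases hk : Even k
  · have hz : word (cut (overlap k)) = 0 := by
      rcases (word_overlap k).1 hk with h | h
      · exact (cut_of_zero h).2.1
      · exact (cut_of_two h).2
    simp [hk, letterCount_succ, hz, h0, h1, h2]
  · simp [hk, h0, h1, h2]

theorem overlap_add_three (k : ℕ) :
    overlap (k + 3) = overlap (k + 2) + overlap k + if Even k then 2 else 1 := by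
  obtain ⟨a0, a1, a2⟩ := letterCount_overlap_succ k
  obtain ⟨b0, b1, b2⟩ := letterCount_overlap_succ (k + 1)
  obtain ⟨c0, c1, c2⟩ := letterCount_overlap_succ (k + 2)
  have s0 := (letterCount_cut (overlap k)).2.2.2.2
  have s2 := (letterCount_cut (overlap (k + 2))).2.2.2.2
  have s3 := (letterCount_cut (overlap (k + 3))).2.2.2.2
  have e := overlap_succ (k + 2)
  have s := (letterCount_cut (overlap (k + 2))).2.2.2.1
  simp only [Nat.add_assoc, Nat.reduceAdd] at *
  by_cases hk : Even k <;> simp [hk, Nat.even_add_one] at * <;> omega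

/-- The Narayana part is homogeneous for the recurrence of `overlap_add_three`; the alternating
constants 4 and 5 absorb its parity term. -/
theorem overlap_succ_eq (k : ℕ) :
    3 * overlap (k + 1) + (if Even k then 4 else 5) =
      narayana (k + 2) + narayana (k + 1) + 2 * narayana k := by
  induction k using Nat.strong_induction_on with
  | _ k ih =>
  match k with
  | 0 => decide
  | 1 => decide
  | 2 => decide
  | k + 3 =>
    have h1 := ih k (by omega)
    have h2 := ih (k + 2) (by omega)
    have e0 := narayana_add_three k
    have e1 := narayana_add_three (k + 1)
    have e2 := narayana_add_three (k + 2)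
    have e := overlap_add_three (k + 1)
    simp only [Nat.add_assoc, Nat.reduceAdd] at *
    by_cases hk : Even k <;> simp [hk, Nat.even_add_one] at * <;> omega

theorem overlap_lt_succ (k : ℕ) : overlap (k + 1) < overlap (k + 2) := by
  have h1 := overlap_succ_eq k
  have h2 := overlap_succ_eq (k + 1)
  have n0 := narayana_lt_succ k
  have n1 := narayana_lt_succ (k + 1)
  have n2 := narayana_lt_succ (k + 2)
  have e := narayana_add_three k
  simp only [Nat.add_assoc, Nat.reduceAdd] at *
  by_cases hk : Even k <;> simp [hk, Nat.even_add_one] at * <;> omega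

theorem overlap_succ_strictMono : StrictMono fun k => overlap (k + 1) :=
  strictMono_nat_of_lt_succ overlap_lt_succ

theorem overlap_succ_pos (k : ℕ) : 0 < overlap (k + 1) :=
  lt_of_lt_of_le (by decide : 0 < overlap 1) (overlap_succ_strictMono.monotone (Nat.zero_le k))

theorem narayana_pos (k : ℕ) : 0 < narayana k := (Nat.zero_le k).trans_lt (lt_length_nuIter k)

/-- Source of the threshold 14/5 = 1 + 9/5: in the alternative of `repetition_bound` with period at
least N_{k+1}, the exponent cannot exceed it. -/
theorem five_mul_overlap_le (k : ℕ) : 5 * overlap (k + 1) ≤ 9 * narayana (k + 1) := by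
  have h := overlap_succ_eq k
  have n0 := narayana_lt_succ k
  have n2 : narayana (k + 2) ≤ 2 * narayana (k + 1) := by
    match k with
    | 0 => decide
    | k + 1 =>
      have e := narayana_add_three k
      have := narayana_strictMono.monotone (show k ≤ k + 2 by omega)
      simp only [Nat.add_assoc, Nat.reduceAdd] at *
      omega
  omega

theorem nine_mul_narayana_lt_iff (k : ℕ) : 9 * narayana k < 5 * overlap (k + 1) ↔ 8 ≤ k := by
  constructor
  · intro h
    by_contra hk
    have hk : k < 8 := by omega
    have small : ∀ k < 8, ¬ 9 * narayana k < 5 * overlap (k + 1) := by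
      intro k hk h
      have e := overlap_succ_eq k
      have v0 : narayana 0 = 1 := rfl
      have v1 : narayana 1 = 2 := rfl
      have v2 : narayana 2 = 3 := rfl
      have v3 := narayana_add_three 0
      have v4 := narayana_add_three 1
      have v5 := narayana_add_three 2
      have v6 := narayana_add_three 3
      have v7 := narayana_add_three 4
      have v8 := narayana_add_three 5
      have v9 := narayana_add_three 6
      simp only [Nat.reduceAdd] at *
      interval_cases k <;>
        first
        | (rw [if_pos (by decide)] at e
           simp only [Nat.reduceAdd] at e h
           omega)
        | (rw [if_neg (by decide)] at e
           simp only [Nat.reduceAdd] at e h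
           omega)
    exact small k hk h
  · intro hk
    obtain ⟨j, rfl⟩ := Nat.exists_eq_add_of_le hk
    -- By `overlap_succ_eq` the goal is 17 N_k + 5 c_k < 5 (N_{k+2} + N_{k+1}) with c_k ≤ 5. The
    -- stronger form with 26 is preserved by the Narayana recurrence.
    have key : ∀ j, 17 * narayana (8 + j) + 26 ≤
        5 * (narayana (8 + j + 2) + narayana (8 + j + 1)) := by
      intro j
      induction j using Nat.strong_induction_on with
      | _ j ih =>
      have v0 : narayana 0 = 1 := rfl
      have v1 : narayana 1 = 2 := rfl
      have v2 : narayana 2 = 3 := rfl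
      have v3 := narayana_add_three 0
      have v4 := narayana_add_three 1
      have v5 := narayana_add_three 2
      have v6 := narayana_add_three 3
      have v7 := narayana_add_three 4
      have v8 := narayana_add_three 5
      have v9 := narayana_add_three 6
      have v10 := narayana_add_three 7
      have v11 := narayana_add_three 8
      have v12 := narayana_add_three 9
      simp only [Nat.reduceAdd] at *
      match j with
      | 0 => simp only [Nat.reduceAdd]; omega
      | 1 => simp only [Nat.reduceAdd]; omega
      | 2 => simp only [Nat.reduceAdd]; omega
      | j + 3 =>
        have h1 := ih j (by omega)
        have h2 := ih (j + 2) (by omega)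
        have e0 := narayana_add_three (8 + j)
        have e1 := narayana_add_three (8 + j + 1)
        have e2 := narayana_add_three (8 + j + 2)
        simp only [Nat.add_assoc, Nat.reduceAdd] at *
        omega
    have e := overlap_succ_eq (8 + j)
    have h := key j
    by_cases hj : Even (8 + j) <;> simp only [hj, if_true, if_false] at e <;> omega

/-! ### The real root -/

/-- The bracket has width 10⁻²⁸, fine enough for the 24-digit claims about both α and β. -/
theorem exists_root : ∃ α : ℝ, α ^ 3 = α ^ 2 + 1 ∧
    1.4655712318767680266567312252 < α ∧ α < 1.4655712318767680266567312253 := by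
  have hc : ContinuousOn (fun x : ℝ => x ^ 3 - x ^ 2)
      (Set.Icc 1.4655712318767680266567312252 1.4655712318767680266567312253) := by fun_prop
  have h := intermediate_value_Ioo (by norm_num) hc
  obtain ⟨α, hα, e⟩ := h (show (1 : ℝ) ∈ _ by constructor <;> norm_num)
  exact ⟨α, by simp only at e; linarith, hα.1, hα.2⟩

/-- Dividing the cubic by X - α leaves a quadratic of discriminant -(α - 1)(3α + 1) < 0. -/
theorem eq_of_root {α x : ℝ} (hα : α ^ 3 = α ^ 2 + 1) (h1 : 1.46 < α) (hx : x ^ 3 = x ^ 2 + 1) :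
    x = α := by
  have h : (x - α) * (x ^ 2 + (α - 1) * x + α * (α - 1)) = 0 := by linear_combination hx - hα
  rcases mul_eq_zero.1 h with h | h
  · linarith
  · nlinarith [sq_nonneg (2 * x + (α - 1))]

/-- The differences `N_{k+1} - α N_k` stay small. -/
theorem abs_narayana_succ_sub_le {α : ℝ} (hα : α ^ 3 = α ^ 2 + 1) (h1 : 1.46 < α) (h2 : α < 1.47)
    (k : ℕ) : |(narayana (k + 1) : ℝ) - α * narayana k| ≤ 1 := by
  have rec2 : ∀ k : ℕ, (narayana (k + 3) : ℝ) = narayana (k + 2) + narayana k := fun k => by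
    exact_mod_cast narayana_add_three k
  -- The differences obey the second-order recurrence of the quadratic cofactor of X - α. This
  -- positive definite form, built from that cofactor, is divided by α at each step, so its initial
  -- bound persists.
  have hQ : ∀ k : ℕ, ((narayana (k + 2) : ℝ) - α * narayana (k + 1)) ^ 2 +
      (α - 1) * (narayana (k + 2) - α * narayana (k + 1)) * (narayana (k + 1) - α * narayana k) +
      α * (α - 1) * (narayana (k + 1) - α * narayana k) ^ 2 ≤ 1 / 2 := by
    intro k
    induction k with
    | zero =>
      have v0 : narayana 0 = 1 := rfl
      have v1 : narayana 1 = 2 := rfl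
      have v2 : narayana 2 = 3 := rfl
      simp only [Nat.zero_add, v0, v1, v2]
      push_cast
      nlinarith [mul_pos (sub_pos.2 h1) (sub_pos.2 h2)]
    | succ k ih =>
      generalize ha : (narayana k : ℝ) = a at *
      generalize hb : (narayana (k + 1) : ℝ) = b at *
      generalize hc : (narayana (k + 2) : ℝ) = c at *
      have hd := rec2 k
      rw [hc, ha] at hd
      rw [show k + 1 + 2 = k + 3 from rfl, hd]
      have hw : c + a - α * c = -(α - 1) * (c - α * b) - α * (α - 1) * (b - α * a) := by
        linear_combination -a * hα
      rw [hw]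
      generalize c - α * b = v at *
      generalize b - α * a = u at *
      have key : v ^ 2 + (α - 1) * v * u + α * (α - 1) * u ^ 2 =
          α * ((-(α - 1) * v - α * (α - 1) * u) ^ 2 +
            (α - 1) * (-(α - 1) * v - α * (α - 1) * u) * v + α * (α - 1) * v ^ 2) := by
        linear_combination -(v ^ 2 + (α - 1) * v * u + α * (α - 1) * u ^ 2) * hα
      rw [key] at ih
      nlinarith
  have h := hQ k
  rw [abs_le]
  constructor <;>
  nlinarith [sq_nonneg (2 * ((narayana (k + 2) : ℝ) - α * narayana (k + 1)) +
    (α - 1) * (narayana (k + 1) - α * narayana k)), sq_nonneg ((narayana (k + 1) : ℝ) - α * narayana k - 1)]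

/-! ### Periods of factors -/

theorem hasPeriod_factorAt_iff {A : Type*} {w : ℕ → A} {i m p : ℕ} :
    (factorAt w i m).HasPeriod p ↔ ∀ t < m - p, w (i + t) = w (i + p + t) := by
  rw [List.hasPeriod_iff_getElem?, length_factorAt]
  refine forall₂_congr fun t ht => ?_
  rw [List.getElem?_eq_getElem (by rw [length_factorAt]; omega),
    List.getElem?_eq_getElem (by rw [length_factorAt]; omega), Option.some_inj]
  simp [factorAt, Nat.add_assoc, Nat.add_comm p t]

theorem per_spec {A : Type*} {x : List A} (hx : x ≠ []) :
    1 ≤ per x ∧ per x ≤ x.length ∧ x.HasPeriod (per x) :=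
  Nat.sInf_mem (s := {p : ℕ | 1 ≤ p ∧ p ≤ x.length ∧ x.HasPeriod p})
    ⟨x.length, List.length_pos_of_ne_nil hx, le_rfl, x.hasPeriod_of_length_le _ le_rfl⟩

theorem per_le {A : Type*} {x : List A} {p : ℕ} (h1 : 1 ≤ p) (h2 : p ≤ x.length)
    (h3 : x.HasPeriod p) : per x ≤ p := Nat.sInf_le ⟨h1, h2, h3⟩

theorem factor_bound {x : List (Fin 3)} (hx : IsFactor x word) (hp : per x < x.length) :
    ∃ k, x.length ≤ per x + overlap (k + 1) ∧ (per x = narayana k ∨ narayana (k + 1) ≤ per x) := by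
  have hne : x ≠ [] := by rintro rfl; simp at hp
  obtain ⟨h1, -, h3⟩ := per_spec hne
  obtain ⟨i, m, hxe⟩ := hx
  have hm : x.length = m := by rw [hxe, length_factorAt]
  rw [hxe, hasPeriod_factorAt_iff, ← hxe] at h3
  obtain ⟨k, hk, hk'⟩ := repetition_bound (L := m - per x) h1 (by omega) h3
  exact ⟨k, by omega, hk'⟩

theorem exists_factor (k : ℕ) :
    ∃ x, IsFactor x word ∧ x.length = overlap (k + 1) + narayana k ∧ per x ≤ narayana k := by
  obtain ⟨i, hi⟩ := exists_repetition k
  refine ⟨factorAt word i (overlap (k + 1) + narayana k), ⟨_, _, rfl⟩, length_factorAt _ _ _,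
    per_le (narayana_pos k) (by rw [length_factorAt]; omega) ?_⟩
  rw [hasPeriod_factorAt_iff, Nat.add_sub_cancel]
  exact hi

/-- A factor as long as the `k`-th extremal repetition has at least its period. -/
theorem narayana_le_per {x : List (Fin 3)} {k : ℕ} (hx : IsFactor x word)
    (h : overlap (k + 1) + narayana k ≤ x.length) :
    narayana k ≤ per x ∧ (overlap (k + 1) + narayana k < x.length → narayana k < per x) := by
  have hk0 := overlap_succ_pos k
  by_cases hp : narayana k < per x
  · exact ⟨hp.le, fun _ => hp⟩
  obtain ⟨j, hj, hj'⟩ := factor_bound hx (by omega)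
  have hjp : narayana j ≤ per x := by
    have := narayana_lt_succ j
    omega
  have hkj : k ≤ j :=
    overlap_succ_strictMono.le_iff_le.1 (show overlap (k + 1) ≤ overlap (j + 1) by omega)
  have hN := narayana_strictMono.monotone hkj
  refine ⟨hN.trans hjp, fun hlt => ?_⟩
  have hkj' : k < j :=
    overlap_succ_strictMono.lt_iff_lt.1 (show overlap (k + 1) < overlap (j + 1) by omega)
  have := narayana_strictMono hkj'
  omega

theorem isMaximalRepetition_iff (m p : ℕ) :
    (IsMaximalRepetition word m p ∧ 14 * p < 5 * m) ↔
      ∃ k, 8 ≤ k ∧ m = overlap (k + 1) + narayana k ∧ p = narayana k := by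
  constructor
  · rintro ⟨⟨-, ⟨x, hx, rfl, rfl⟩, -, h4⟩, hlt⟩
    obtain ⟨k, hk, hk'⟩ := factor_bound hx (by omega)
    -- The other alternative, period at least N_{k+1}, would force exponent at most 14/5.
    have hp : per x = narayana k := by
      have := five_mul_overlap_le k
      omega
    obtain ⟨y, hy, hyl, hyp⟩ := exists_factor k
    have hm : x.length = overlap (k + 1) + narayana k := by
      -- Otherwise the extremal factor would be longer without a larger period, against maximality.
      by_contra hne
      have := h4 y hy (by omega)
      omega
    exact ⟨k, (nine_mul_narayana_lt_iff k).1 (by omega), hm, hp⟩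
  · rintro ⟨k, hk, rfl, rfl⟩
    have h8 := (nine_mul_narayana_lt_iff k).2 hk
    obtain ⟨y, hy, hyl, hyp⟩ := exists_factor k
    refine ⟨⟨by omega, ⟨y, hy, hyl, le_antisymm hyp (narayana_le_per hy hyl.ge).1⟩, ?_, ?_⟩,
      by omega⟩
    · exact fun x hx hl => (narayana_le_per hx hl.ge).1
    · exact fun x hx hl => (narayana_le_per hx hl.le).2 hl

/-! ### Exponents -/

section Exponents

variable {α : ℝ} (hα : α ^ 3 = α ^ 2 + 1) (h1 : 1.46 < α) (h2 : α < 1.47)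

include hα h1 h2

/-- Replacing N_{k+1} and N_{k+2} by αN_k and α²N_k costs at most 2 + α < 4 in absolute value. The
subtracted constant is at least 4, hence the strict upper bound; it is at most 5, hence a loss of at
most 9/3 = 3. -/
theorem overlap_bounds (k : ℕ) :
    (overlap (k + 1) : ℝ) < (α ^ 2 + α + 2) / 3 * narayana k ∧
      (α ^ 2 + α + 2) / 3 * narayana k - 3 ≤ overlap (k + 1) := by
  have e0 := abs_le.1 (abs_narayana_succ_sub_le hα h1 h2 k)
  have e1 := abs_le.1 (abs_narayana_succ_sub_le hα h1 h2 (k + 1))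
  have h : (3 * overlap (k + 1) + (if Even k then 4 else 5) : ℝ) =
      narayana (k + 2) + narayana (k + 1) + 2 * narayana k := by
    exact_mod_cast overlap_succ_eq k
  have hc : (4 : ℝ) ≤ (if Even k then 4 else 5) ∧ (if Even k then 4 else 5 : ℝ) ≤ 5 := by
    split_ifs <;> norm_num
  rw [show k + 1 + 1 = k + 2 from rfl] at e1
  constructor <;> nlinarith

theorem exponent_lt {x : List (Fin 3)} (hne : x ≠ []) (hx : IsFactor x word) :
    exponent x < (α ^ 2 + α + 5) / 3 := by
  obtain ⟨hp1, hpl, -⟩ := per_spec hne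
  have hp0 : (0 : ℝ) < per x := by exact_mod_cast hp1
  rw [exponent, div_lt_iff₀ hp0]
  rcases hpl.eq_or_lt with h | h
  -- Period equal to the length means exponent 1.
  · rw [← h]
    nlinarith
  · obtain ⟨k, hk, hk'⟩ := factor_bound hx h
    have hkp : narayana k ≤ per x := by
      have := narayana_lt_succ k
      omega
    have hb := (overlap_bounds hα h1 h2 k).1
    have hk1 : (x.length : ℝ) ≤ per x + overlap (k + 1) := by exact_mod_cast hk
    have hk2 : (narayana k : ℝ) ≤ per x := by exact_mod_cast hkp
    have hb2 : (α ^ 2 + α + 2) / 3 * narayana k ≤ (α ^ 2 + α + 2) / 3 * per x :=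
      mul_le_mul_of_nonneg_left hk2 (by positivity)
    linarith

theorem tendsto_extremal :
    Filter.Tendsto (fun k : ℕ => ((overlap (k + 1) + narayana k : ℕ) : ℝ) / (narayana k : ℝ))
      Filter.atTop (nhds ((α ^ 2 + α + 5) / 3)) := by
  have hN : Filter.Tendsto (fun k : ℕ => (narayana k : ℝ)) Filter.atTop Filter.atTop :=
    tendsto_natCast_atTop_atTop.comp narayana_strictMono.tendsto_atTop
  have hlow : Filter.Tendsto (fun k : ℕ => (α ^ 2 + α + 5) / 3 - 3 / (narayana k : ℝ))
      Filter.atTop (nhds ((α ^ 2 + α + 5) / 3)) := by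
    simpa using tendsto_const_nhds.sub (hN.const_div_atTop 3)
  refine tendsto_of_tendsto_of_tendsto_of_le_of_le hlow tendsto_const_nhds (fun k => ?_)
    (fun k => ?_)
  · have hk : (0 : ℝ) < narayana k := by exact_mod_cast narayana_pos k
    have := (overlap_bounds hα h1 h2 k).2
    simp only
    rw [le_div_iff₀ hk, sub_mul, div_mul_cancel₀ _ hk.ne']
    push_cast
    linarith
  · have hk : (0 : ℝ) < narayana k := by exact_mod_cast narayana_pos k
    have := (overlap_bounds hα h1 h2 k).1
    simp only
    rw [div_le_iff₀ hk]
    push_cast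
    linarith

theorem criticalExponent_word :
    criticalExponent word = (((α ^ 2 + α + 5) / 3 : ℝ) : EReal) := by
  refine le_antisymm (sSup_le ?_) (le_of_forall_lt fun c hc => ?_)
  · rintro e ⟨x, hne, hx, rfl⟩
    exact EReal.coe_le_coe_iff.2 (exponent_lt hα h1 h2 hne hx).le
  · have ht := (continuous_coe_real_ereal.tendsto _).comp (tendsto_extremal hα h1 h2)
    obtain ⟨k, hk⟩ := (ht.eventually (lt_mem_nhds hc)).exists
    obtain ⟨x, hx, hl, hp⟩ := exists_factor k
    have hne : x ≠ [] := by
      rintro rfl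
      have := narayana_pos k
      simp at hl
      omega
    refine lt_of_lt_of_le hk (le_trans ?_ (le_sSup ⟨x, hne, hx, rfl⟩))
    refine EReal.coe_le_coe_iff.2 ?_
    rw [exponent, hl]
    have hp1 : (0 : ℝ) < per x := by exact_mod_cast (per_spec hne).1
    have hp2 : (per x : ℝ) ≤ narayana k := by exact_mod_cast hp
    exact div_le_div_of_nonneg_left (Nat.cast_nonneg _) hp1 hp2

end Exponents

end Narayana

theorem theorem11 :
    ∃ α : ℝ,
      -- `α` is the unique real root of `X ^ 3 = X ^ 2 + 1`
      (∀ x : ℝ, x ^ 3 = x ^ 2 + 1 ↔ x = α) ∧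
      |α - 1.465571231876768026656731| < 1 / 10 ^ 24 ∧
      |(α ^ 2 + α + 5) / 3 - 2.871156755860518460227649| < 1 / 10 ^ 24 ∧
      -- the critical exponent
      Narayana.criticalExponent Narayana.word = (((α ^ 2 + α + 5) / 3 : ℝ) : EReal) ∧
      -- it is not attained
      (∀ x : List (Fin 3), x ≠ [] → Narayana.IsFactor x Narayana.word →
        Narayana.exponent x < (α ^ 2 + α + 5) / 3) ∧
      -- it is approached by the maximal repetitions of exponent larger than `14 / 5`
      ∃ ℓ : ℕ → ℕ,
        (∀ k : ℕ, 3 * ℓ k + (if Even k then 4 else 5) =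
          Narayana.narayana (k + 2) + Narayana.narayana (k + 1) + 5 * Narayana.narayana k) ∧
        (∀ m p : ℕ,
          (Narayana.IsMaximalRepetition Narayana.word m p ∧ 14 * p < 5 * m) ↔
            ∃ k : ℕ, 8 ≤ k ∧ m = ℓ k ∧ p = Narayana.narayana k) ∧
        Filter.Tendsto (fun k : ℕ => (ℓ k : ℝ) / (Narayana.narayana k : ℝ)) Filter.atTop
          (nhds ((α ^ 2 + α + 5) / 3)) := by
  obtain ⟨α, hα, hlo, hhi⟩ := Narayana.exists_root
  have h1 : 1.46 < α := lt_trans (by norm_num) hlo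
  have h2 : α < 1.47 := lt_trans hhi (by norm_num)
  refine ⟨α, fun x => ⟨Narayana.eq_of_root hα h1, fun h => h ▸ hα⟩, ?_, ?_,
    Narayana.criticalExponent_word hα h1 h2,
    fun x hne hx => Narayana.exponent_lt hα h1 h2 hne hx,
    fun k => Narayana.overlap (k + 1) + Narayana.narayana k, fun k => ?_,
    Narayana.isMaximalRepetition_iff, Narayana.tendsto_extremal hα h1 h2⟩
  · rw [abs_lt]
    constructor <;> linarith
  · rw [abs_lt]
    constructor <;> nlinarith
  · have := Narayana.overlap_succ_eq k
    simp only
    omega
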